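/- Let $\alpha>0$, let $N\ge 0$ be an integer, and let $a_{2k+1},b_{2k+1}\in\mathbb R$ $(0\le k\le N)$ with $a_{2N+1}\neq 0$ or $b_{2N+1}\neq 0$. Put $$p(\theta)=\frac{\alpha}{2}+\sum_{k=0}^{N}\bigl(a_{2k+1}\cos((2k+1)\theta)+b_{2k+1}\sin((2k+1)\theta)\bigr)$$ and suppose that $p(\theta)+p''(\theta)\ge 0$ for all $\theta\in\mathbb R$. Let $\mathcal C\subset\mathbb R^2$ be the corresponding algebraic curve of constant width $\alpha$, that is, the image of $$\theta\in[-\pi,\pi]\longmapsto \bigl(p(\theta)\cos\theta-p'(\theta)\sin\theta,\; p(\theta)\sin\theta+p'(\theta)\cos\theta\bigr),$$ and suppose that $\mathcal C$ is not a circle. Then $\mathcal C$ has a defining polynomial, that is, an irreducible $f\in\mathbb R[x,y]$ that generates the ideal of all real polynomials vanishing on $\mathcal C$ (so $f$ is unique up to a nonzero constant factor), and every such $f$ has total degree $4N+4$ and partial degrees $\deg_x f=\deg_y f=4N+4$. -/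

import Mathlib

noncomputable section

namespace ConstantWidth

/-- The trigonometric polynomial
`p(θ) = α/2 + ∑_{k=0}^{N} (a_{2k+1} cos((2k+1)θ) + b_{2k+1} sin((2k+1)θ))`.
Only the values of `a` and `b` at odd indices up to `2N+1` are used. -/
def oddSupport (α : ℝ) (N : ℕ) (a b : ℕ → ℝ) (θ : ℝ) : ℝ :=
  α / 2 + ∑ k ∈ Finset.range (N + 1),
    (a (2 * k + 1) * Real.cos (((2 * k + 1 : ℕ) : ℝ) * θ) +
      b (2 * k + 1) * Real.sin (((2 * k + 1 : ℕ) : ℝ) * θ))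

/-- The parametrization `γ(θ) = (p cos θ - p' sin θ, p sin θ + p' cos θ)`. -/
def param (p : ℝ → ℝ) (θ : ℝ) : Fin 2 → ℝ :=
  ![p θ * Real.cos θ - deriv p θ * Real.sin θ,
    p θ * Real.sin θ + deriv p θ * Real.cos θ]

/-- The planar curve traced by `γ` on `[-π, π]`. -/
def curve (p : ℝ → ℝ) : Set (Fin 2 → ℝ) :=
  param p '' Set.Icc (-Real.pi) Real.pi

/-- The convexity condition `p + p'' ≥ 0`. -/
def ConvexitySupport (p : ℝ → ℝ) : Prop :=
  ∀ θ : ℝ, 0 ≤ p θ + deriv (deriv p) θ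

/-- `C` is the algebraic curve of constant width `α` with the coefficients `a`, `b` up to
order `2N+1`. -/
structure IsConstantWidthCurve (C : Set (Fin 2 → ℝ)) (α : ℝ) (N : ℕ) (a b : ℕ → ℝ) :
    Prop where
  width_pos : 0 < α
  eq_curve : C = curve (oddSupport α N a b)
  convexity : ConvexitySupport (oddSupport α N a b)

/-- `C` is a Euclidean circle of positive radius. -/
def IsCircle (C : Set (Fin 2 → ℝ)) : Prop :=
  ∃ (c : Fin 2 → ℝ) (r : ℝ), 0 < r ∧
    C = {q | (q 0 - c 0) ^ 2 + (q 1 - c 1) ^ 2 = r ^ 2}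

/-- `f` is a defining polynomial of `C`: it is irreducible and generates the ideal of all real
polynomials that vanish on `C`. -/
def IsDefiningPolynomial (f : MvPolynomial (Fin 2) ℝ) (C : Set (Fin 2 → ℝ)) : Prop :=
  Irreducible f ∧ MvPolynomial.vanishingIdeal ℝ C = Ideal.span {f}

end ConstantWidth

end

/-! Put z = exp(iθ). Since x + iy = (p + ip')z and x - iy = (p - ip')/z, the coordinates are Laurent
polynomials in z. A first harmonic only translates a circle, so N ≥ 1, and then x and y have poles
of order exactly 2N+2 at both 0 and ∞. The real polynomials vanishing on the curve form the kernel
of the substitution ℝ[x,y] → ℂ(z): a nonzero, nonmaximal prime, hence principal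
(`exists_irreducible_span_eq`).

Lower bound: [ℂ(z):ℂ(x)] = [ℂ(z):ℂ(y)] = 4N+4, and once ℂ(x,y) = ℂ(z) these indices bound the
partial degrees of f from below (`finrank_le_degreeOf_zero`). For the equality of fields
(`adjoin_coord_eq_top`), x + iy has degree 4N+2, so [ℂ(z):ℂ(x,y)] divides 2. An involution over
ℂ(x,y) would fix x + iy, whose poles at 0 and ∞ have the different orders 2N and 2N+2 and whose
coefficient of z is α/2 ≠ 0; this forces z ↦ z.

Upper bound (`totalDegree_le`): with M = 2N+2, a polynomial of degree at most D vanishes on the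
curve once it vanishes at 2MD+1 sample points, so the Hilbert function of the curve grows with slope
at most 2M = 4N+4, while its slope is deg f. -/

namespace ConstantWidth

open Polynomial IntermediateField

/-! ### Extension degrees and partial degrees of a relation -/

/-- For coprime `p` and `q`, the field `K(X)` has degree `max (deg p) (deg q)` over `K(p / q)`. -/
theorem finrank_adjoin_div_of_isCoprime {K : Type*} [Field K] {p q : K[X]} (hq : q ≠ 0)
    (h : IsCoprime p q) :
    Module.finrank K⟮(algebraMap K[X] (RatFunc K) p / algebraMap K[X] (RatFunc K) q)⟯ (RatFunc K) =
      max p.natDegree q.natDegree := by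
  set f := algebraMap K[X] (RatFunc K) p / algebraMap K[X] (RatFunc K) q with hf
  have key : f.num * q = p * f.denom := (RatFunc.num_mul_eq_mul_denom_iff hq).2 hf
  have hd : Associated f.denom q := by
    refine associated_of_dvd_dvd (RatFunc.denom_div_dvd p q) ?_
    exact h.symm.dvd_of_dvd_mul_left (Dvd.intro_left _ key)
  have hn : Associated f.num p := by
    refine associated_of_dvd_dvd (RatFunc.num_div_dvd p hq) ?_
    exact h.dvd_of_dvd_mul_right (Dvd.intro _ key.symm)
  rw [RatFunc.finrank_eq_max_natDegree,
    natDegree_eq_of_degree_eq (degree_eq_degree_of_associated hd),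
    natDegree_eq_of_degree_eq (degree_eq_degree_of_associated hn)]

/-- A polynomial relation bounds the degree of a minimal polynomial. -/
theorem natDegree_minpoly_le_degreeOf_zero {F k L : Type*} [Field F] [Field k] [Field L]
    [Algebra F k] [Algebra k L] [Algebra F L] [IsScalarTower F k L] (u v : L)
    (hu : Transcendental F u) {f : MvPolynomial (Fin 2) F} (hf : f ≠ 0)
    (h : MvPolynomial.aeval ![v, u] f = 0) :
    (minpoly k⟮u⟯ v).natDegree ≤ MvPolynomial.degreeOf 0 f := by
  have : IsScalarTower F k⟮u⟯ L := IsScalarTower.of_algebraMap_eq fun _ => rfl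
  let u' : k⟮u⟯ := AdjoinSimple.gen k u
  have hu' : Transcendental F u' := by
    intro H
    have := H.algebraMap (A := L)
    exact hu this
  let ψ : MvPolynomial (Fin 1) F →ₐ[F] k⟮u⟯ := MvPolynomial.aeval fun _ => u'
  have hψ : Function.Injective ψ := by
    have := (algebraicIndependent_unique_type_iff (ι := Fin 1) (R := F) (x := fun _ => u')).2 hu'
    exact this
  -- This is f(T, u) as a polynomial in T. It is nonzero because u is transcendental over the field
  -- F of coefficients, which may be smaller than k (later ℝ inside ℂ).
  let g : k⟮u⟯[X] := (MvPolynomial.finSuccEquiv F 1 f).map (ψ : MvPolynomial (Fin 1) F →+* k⟮u⟯)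
  have hg : g ≠ 0 := by
    refine (Polynomial.map_ne_zero_iff hψ).2 ?_
    simpa using hf
  have hroot : aeval v g = 0 := by
    rw [← h]
    have : ((aeval v : k⟮u⟯[X] →ₐ[k⟮u⟯] L).restrictScalars F).comp
        (((Polynomial.mapAlgHom ψ).comp (MvPolynomial.finSuccEquiv F 1).toAlgHom)) =
        MvPolynomial.aeval ![v, u] := by
      ext i
      fin_cases i
      · simp [MvPolynomial.finSuccEquiv_X_zero]
      · have : MvPolynomial.finSuccEquiv F 1 (MvPolynomial.X 1) = C (MvPolynomial.X 0) :=
          MvPolynomial.finSuccEquiv_X_succ (j := 0)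
        simp [this, ψ, u']
    exact congrArg (fun t => t f) this
  calc (minpoly k⟮u⟯ v).natDegree ≤ g.natDegree :=
        natDegree_le_natDegree (minpoly.degree_le_of_ne_zero _ _ hg hroot)
    _ ≤ (MvPolynomial.finSuccEquiv F 1 f).natDegree := natDegree_map_le
    _ = _ := MvPolynomial.natDegree_finSuccEquiv f

/-- If `u` and `v` generate a finite extension of `k(u)`, a nonzero relation `f (v, u) = 0` has
degree at least `[L : k(u)]` in the first variable. -/
theorem finrank_le_degreeOf_zero {F k L : Type*} [Field F] [Field k] [Field L]
    [Algebra F k] [Algebra k L] [Algebra F L] [IsScalarTower F k L] (u v : L)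
    (hu : Transcendental F u) (hfin : Module.finrank k⟮u⟯ L ≠ 0) (htop : k⟮u, v⟯ = ⊤)
    {f : MvPolynomial (Fin 2) F} (hf : f ≠ 0) (h : MvPolynomial.aeval ![v, u] f = 0) :
    Module.finrank k⟮u⟯ L ≤ MvPolynomial.degreeOf 0 f := by
  refine le_trans (le_of_eq ?_) (natDegree_minpoly_le_degreeOf_zero (k := k) u v hu hf h)
  -- `finrank` is 0 for infinite extensions, so its nonvanishing encodes finiteness.
  have : FiniteDimensional k⟮u⟯ L := FiniteDimensional.of_finrank_pos (Nat.pos_of_ne_zero hfin)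
  rw [← adjoin.finrank (IsIntegral.of_finite k⟮u⟯ v)]
  have htop' : (k⟮u⟯)⟮v⟯ = ⊤ := by
    rw [← restrictScalars_eq_top_iff (K := k), adjoin_simple_adjoin_simple, htop]
  rw [htop', finrank_top']

theorem finrank_le_degreeOf_one {F k L : Type*} [Field F] [Field k] [Field L]
    [Algebra F k] [Algebra k L] [Algebra F L] [IsScalarTower F k L] (u v : L)
    (hu : Transcendental F u) (hfin : Module.finrank k⟮u⟯ L ≠ 0) (htop : k⟮u, v⟯ = ⊤)
    {f : MvPolynomial (Fin 2) F} (hf : f ≠ 0) (h : MvPolynomial.aeval ![u, v] f = 0) :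
    Module.finrank k⟮u⟯ L ≤ MvPolynomial.degreeOf 1 f := by
  have hinj := (Equiv.swap (0 : Fin 2) 1).injective
  have := finrank_le_degreeOf_zero u v hu hfin htop
    (f := MvPolynomial.rename (Equiv.swap (0 : Fin 2) 1) f)
    (fun h0 => hf ((MvPolynomial.rename_injective _ hinj) (by simpa using h0))) (by
      rw [MvPolynomial.aeval_rename, ← h]
      congr 2
      funext i
      fin_cases i <;> simp)
  have h2 := MvPolynomial.degreeOf_rename_of_injective (p := f) hinj 1
  simp only [Equiv.swap_apply_right] at h2
  rwa [h2] at this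

/-! ### Substitutions that fix a Laurent polynomial -/

/-- A rational function whose image under `P / X ^ m` is that of `X` is a monomial, possibly with
negative exponent. -/
theorem eq_C_mul_zpow_of_aeval_mul_eq {K : Type*} [Field K] {P : K[X]} {m : ℕ} (hm : 0 < m)
    (hmP : m < P.natDegree) (h0 : P.coeff 0 ≠ 0) {r : RatFunc K}
    (hr : aeval r P * RatFunc.X ^ m = algebraMap K[X] (RatFunc K) P * r ^ m) :
    ∃ (c : K) (k : ℤ), r = RatFunc.C c * RatFunc.X ^ k := by
  have hP : P ≠ 0 := by rintro rfl; simp at h0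
  -- Q(T) = X^m P(T) - P(X) T^m has the root r. As 0 < m < deg P, its leading and constant
  -- coefficients are nonzero constants times X^m, so by the rational root theorem the numerator and
  -- denominator of r are powers of X up to units.
  let Q : K[X][X] := C (X ^ m) * P.map C - C P * X ^ m
  have hroot : aeval r Q = 0 := by
    have : aeval r (P.map (C : K →+* K[X])) = aeval r P := by
      rw [← Polynomial.algebraMap_eq, aeval_map_algebraMap]
    simp only [Q, map_sub, map_mul, aeval_C, map_pow, aeval_X, this, RatFunc.algebraMap_X]
    rw [mul_comm, hr, sub_self]
  have hlead : Q.leadingCoeff = X ^ m * C P.leadingCoeff := by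
    rw [leadingCoeff_sub_of_degree_lt, leadingCoeff_mul, leadingCoeff_C,
      leadingCoeff_map_of_injective C_injective]
    rw [degree_mul, degree_mul, degree_C (pow_ne_zero _ X_ne_zero), zero_add, degree_C hP,
      zero_add, degree_X_pow, degree_map_eq_of_injective C_injective, degree_eq_natDegree hP]
    exact_mod_cast hmP
  have hconst : Q.coeff 0 = X ^ m * C (P.coeff 0) := by
    simp only [Q, coeff_sub, coeff_C_mul, coeff_map, coeff_X_pow, hm.ne, if_false, mul_zero,
      sub_zero]
  have hden := den_dvd_of_is_root (A := K[X]) hroot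
  have hnum := num_dvd_of_is_root (A := K[X]) hroot
  rw [hlead, (isUnit_C.2 (isUnit_iff_ne_zero.2 (leadingCoeff_ne_zero.2 hP))).dvd_mul_right] at hden
  rw [hconst, (isUnit_C.2 (isUnit_iff_ne_zero.2 h0)).dvd_mul_right] at hnum
  obtain ⟨i, -, hi⟩ := (dvd_prime_pow prime_X m).1 hnum
  obtain ⟨j, -, hj⟩ := (dvd_prime_pow prime_X m).1 hden
  obtain ⟨s, hs⟩ := hi.symm
  obtain ⟨t, ht⟩ := hj.symm
  obtain ⟨s', hs'u, hs'⟩ := Polynomial.isUnit_iff.1 s.isUnit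
  obtain ⟨t', ht'u, ht'⟩ := Polynomial.isUnit_iff.1 t.isUnit
  refine ⟨s' / t', (i : ℤ) - j, ?_⟩
  have hr' := IsFractionRing.mk'_num_den' K[X] r
  rw [← hr', ← hs, ← ht, ← hs', ← ht', zpow_sub₀ RatFunc.X_ne_zero]
  simp only [map_mul, map_pow, RatFunc.algebraMap_X, RatFunc.algebraMap_C, zpow_natCast, map_div₀]
  field_simp

/-- The Laurent polynomial `P / X ^ m`, when its pole order at infinity exceeds that at `0` by two
and its coefficient of `X` is nonzero, is fixed by no nontrivial substitution. -/
theorem eq_X_of_aeval_mul_eq {K : Type*} [Field K] {P : K[X]} {m : ℕ} (hm : 0 < m)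
    (hdeg : P.natDegree = m + (m + 2)) (h0 : P.coeff 0 ≠ 0) (h1 : P.coeff (m + 1) ≠ 0)
    {r : RatFunc K} (hr0 : ¬ ∃ c, r = RatFunc.C c)
    (hr : aeval r P * RatFunc.X ^ m = algebraMap K[X] (RatFunc K) P * r ^ m) :
    r = RatFunc.X := by
  have hP : P ≠ 0 := by rintro rfl; simp at h0
  obtain ⟨c, k, rfl⟩ := eq_C_mul_zpow_of_aeval_mul_eq hm (by omega) h0 hr
  have hc : c ≠ 0 := by
    rintro rfl
    exact hr0 ⟨0, by simp⟩
  have hinj := RatFunc.algebraMap_injective K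
  obtain ⟨n, rfl | rfl⟩ := k.eq_nat_or_neg
  · have hn : n ≠ 0 := by
      rintro rfl
      exact hr0 ⟨c, by simp⟩
    have e1 : RatFunc.C c * RatFunc.X ^ (n : ℤ) = algebraMap K[X] (RatFunc K) (C c * X ^ n) := by
      simp
    rw [e1, aeval_algebraMap_apply, ← RatFunc.algebraMap_X, ← map_pow, ← map_pow,
      ← map_mul, ← map_mul] at hr
    replace hr := hinj hr
    rw [← comp_eq_aeval] at hr
    have hd := congrArg natDegree hr
    have hcomp : P.comp (C c * X ^ n) ≠ 0 := by
      intro h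
      rw [h, zero_mul] at hr
      exact mul_ne_zero hP (pow_ne_zero _ (mul_ne_zero (C_ne_zero.2 hc)
        (pow_ne_zero _ X_ne_zero))) hr.symm
    rw [natDegree_mul hcomp (pow_ne_zero _ X_ne_zero), natDegree_mul hP
      (pow_ne_zero _ (mul_ne_zero (C_ne_zero.2 hc) (pow_ne_zero _ X_ne_zero))), natDegree_comp,
      natDegree_pow, natDegree_pow, natDegree_C_mul_X_pow _ _ hc, natDegree_X, hdeg] at hd
    -- Comparing degrees gives (2m+2)n + m = (2m+2) + mn.
    have hn1 : n = 1 := by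
      have : (m + 2) * n = (m + 2) * 1 := by linarith
      exact Nat.eq_of_mul_eq_mul_left (by omega) this
    subst hn1
    have hco := congrArg (fun p => coeff p (m + 1 + m)) hr
    simp only [pow_one, mul_pow, ← C_pow, coeff_mul_X_pow] at hco
    rw [← mul_assoc, coeff_mul_X_pow, comp_C_mul_X_coeff, coeff_mul_C, pow_succ] at hco
    have hc1 : c = 1 := by
      have := mul_left_cancel₀ h1 hco
      exact mul_left_cancel₀ (pow_ne_zero m hc) (by simpa using this)
    simp [hc1]
  · exfalso
    have hn : n ≠ 0 := by
      rintro rfl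
      exact hr0 ⟨c, by simp⟩
    -- A negative exponent would exchange 0 and ∞, where the pole orders differ. With r = 1/s the
    -- relation becomes P.reverse(s) X^m = P s^(m+2); the coefficient of X^m is the leading
    -- coefficient of P on the left and 0 on the right.
    let s : K[X] := C c⁻¹ * X ^ n
    have hs0 : algebraMap K[X] (RatFunc K) s ≠ 0 :=
      (map_ne_zero_iff _ hinj).2 (mul_ne_zero (C_ne_zero.2 (inv_ne_zero hc))
        (pow_ne_zero _ X_ne_zero))
    have e1 : RatFunc.C c * RatFunc.X ^ (-(n : ℤ)) = (algebraMap K[X] (RatFunc K) s)⁻¹ := by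
      simp only [s, map_mul, map_pow, RatFunc.algebraMap_X, RatFunc.algebraMap_C, map_inv₀,
        mul_inv, inv_inv, zpow_neg, zpow_natCast]
    rw [e1] at hr
    let _ : Invertible (algebraMap K[X] (RatFunc K) s)⁻¹ := invertibleOfNonzero (inv_ne_zero hs0)
    have hrev := eval₂_reverse_mul_pow (algebraMap K (RatFunc K))
      (algebraMap K[X] (RatFunc K) s)⁻¹ P
    rw [invOf_eq_inv, inv_inv, ← aeval_def, ← aeval_def, aeval_algebraMap_apply, hdeg] at hrev
    rw [← hrev, pow_add, ← mul_assoc, mul_right_comm,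
      mul_right_comm _ _ (RatFunc.X ^ m), mul_right_comm] at hr
    replace hr := mul_right_cancel₀ (pow_ne_zero m (inv_ne_zero hs0)) hr
    rw [inv_pow, mul_inv_eq_iff_eq_mul₀ (pow_ne_zero _ hs0), ← RatFunc.algebraMap_X, ← map_pow,
      ← map_pow, ← map_mul, ← map_mul] at hr
    replace hr := congrArg (fun p => coeff p m) (hinj hr)
    have hsX : s ^ (m + 2) = C (c⁻¹ ^ (m + 2)) * X ^ (n * (m + 2)) := by
      rw [C_pow, pow_mul, ← mul_pow]
    have hlt : m < n * (m + 2) := by nlinarith [Nat.pos_of_ne_zero hn]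
    have hs' : s.coeff 0 = 0 := by simp [s, coeff_X_pow, hn.symm]
    have hl : ((aeval s P.reverse) * X ^ m).coeff m = P.leadingCoeff := by
      have := coeff_mul_X_pow (aeval s P.reverse) m 0
      rw [zero_add] at this
      rw [this, ← comp_eq_aeval, coeff_zero_eq_eval_zero, eval_comp, ← coeff_zero_eq_eval_zero s,
        hs', ← coeff_zero_eq_eval_zero, coeff_zero_reverse]
    simp only [hl] at hr
    rw [hsX, ← mul_assoc, coeff_mul_X_pow', if_neg (by omega)] at hr
    exact hP (leadingCoeff_eq_zero.1 hr)

theorem algHom_algebraMap_eq_aeval {K A : Type*} [Field K] [CommRing A] [Algebra K A]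
    (σ : RatFunc K →ₐ[K] A) (p : K[X]) :
    σ (algebraMap K[X] (RatFunc K) p) = aeval (σ RatFunc.X) p := by
  have : σ.comp (IsScalarTower.toAlgHom K K[X] (RatFunc K)) = aeval (σ RatFunc.X) := by
    ext
    simp
  exact congrArg (fun t => t p) this

/-- A subfield of `K(X)` of index one or two that contains a Laurent polynomial `P / X ^ m` with
different pole orders at `0` and infinity and a nonzero coefficient of `X` is all of `K(X)`. -/
theorem eq_top_of_finrank_dvd_two {K : Type*} [Field K] [CharZero K] {P : K[X]} {m : ℕ}
    (hm : 0 < m) (hdeg : P.natDegree = m + (m + 2)) (h0 : P.coeff 0 ≠ 0)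
    (h1 : P.coeff (m + 1) ≠ 0) (E : IntermediateField K (RatFunc K))
    (hE : algebraMap K[X] (RatFunc K) P / RatFunc.X ^ m ∈ E)
    (h2 : Module.finrank E (RatFunc K) ∣ 2) : E = ⊤ := by
  rcases (Nat.dvd_prime Nat.prime_two).1 h2 with h | h
  · exact IntermediateField.finrank_eq_one_iff_eq_top.1 h
  exfalso
  have : Algebra.IsQuadraticExtension E (RatFunc K) := ⟨h⟩
  have : CharZero E := charZero_of_injective_algebraMap (algebraMap K E).injective
  have : FiniteDimensional E (RatFunc K) := FiniteDimensional.of_finrank_pos (by omega)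
  have hcard : Nat.card (RatFunc K ≃ₐ[E] RatFunc K) = 2 := by
    rw [IsGalois.card_aut_eq_finrank, h]
  have : Nontrivial (RatFunc K ≃ₐ[E] RatFunc K) := by
    have : Finite (RatFunc K ≃ₐ[E] RatFunc K) := Nat.finite_of_card_ne_zero (by omega)
    exact Finite.one_lt_card_iff_nontrivial.1 (by omega)
  -- A quadratic extension in characteristic 0 is Galois, so it has a nontrivial automorphism; it
  -- fixes P / X^m and hence X.
  obtain ⟨σ, hσ⟩ := exists_ne (1 : RatFunc K ≃ₐ[E] RatFunc K)
  let τ : RatFunc K →ₐ[K] RatFunc K := (σ : RatFunc K →ₐ[E] RatFunc K).restrictScalars K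
  have hτ : ∀ f, τ f = σ f := fun _ => rfl
  have hX : σ RatFunc.X = RatFunc.X := by
    refine eq_X_of_aeval_mul_eq hm hdeg h0 h1 ?_ ?_
    · rintro ⟨c, hc⟩
      have h3 : τ (RatFunc.C c) = RatFunc.C c := by
        rw [← RatFunc.algebraMap_eq_C]
        exact τ.commutes c
      have h4 : RatFunc.X = RatFunc.C c := σ.injective (by rw [hc, ← hτ, h3])
      have h5 : algebraMap K[X] (RatFunc K) X = algebraMap K[X] (RatFunc K) (C c) := by
        simpa using h4
      exact X_ne_C c (RatFunc.algebraMap_injective K h5)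
    · have hfix : σ (algebraMap K[X] (RatFunc K) P / RatFunc.X ^ m) =
          algebraMap K[X] (RatFunc K) P / RatFunc.X ^ m := σ.commutes ⟨_, hE⟩
      have hne : σ RatFunc.X ≠ 0 := by simp [RatFunc.X_ne_zero]
      rw [map_div₀, map_pow, ← hτ, algHom_algebraMap_eq_aeval, hτ,
        div_eq_div_iff (pow_ne_zero _ hne) (pow_ne_zero _ RatFunc.X_ne_zero)] at hfix
      exact hfix
  refine hσ (AlgEquiv.ext fun f => ?_)
  rw [← RatFunc.num_div_denom f, map_div₀, ← hτ, ← hτ, algHom_algebraMap_eq_aeval,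
    algHom_algebraMap_eq_aeval, hτ, hX, RatFunc.aeval_X_left_eq_algebraMap,
    RatFunc.aeval_X_left_eq_algebraMap]
  rfl

/-! ### Principal primes and dimensions in two variables -/

/-- In a polynomial ring in two variables over a field, a nonzero nonmaximal prime is principal. -/
theorem exists_irreducible_span_eq {K : Type*} [Field K] (I : Ideal (MvPolynomial (Fin 2) K))
    [hI : I.IsPrime] (hbot : I ≠ ⊥) (hmax : ¬ I.IsMaximal) :
    ∃ f, Irreducible f ∧ I = Ideal.span {f} := by
  obtain ⟨f, hfI, hf⟩ := hI.exists_mem_prime_of_ne_bot hbot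
  refine ⟨f, hf.irreducible, ?_⟩
  have hle : Ideal.span {f} ≤ I := (Ideal.span_singleton_le_iff_mem I).2 hfI
  by_contra hne
  -- Otherwise 0 < (f) < I < J is a chain of primes of length 3 in a ring of dimension 2.
  have hlt : Ideal.span {f} < I := lt_of_le_of_ne hle (Ne.symm hne)
  have hP : (Ideal.span {f}).IsPrime := (Ideal.span_singleton_prime hf.ne_zero).2 hf
  obtain ⟨J, hJ, hIJ⟩ := I.exists_le_maximal hI.ne_top
  have hIJ' : I < J := lt_of_le_of_ne hIJ fun h => hmax (h ▸ hJ)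
  have hJp := hJ.isPrime
  have hb : (⊥ : Ideal (MvPolynomial (Fin 2) K)) < Ideal.span {f} :=
    bot_lt_iff_ne_bot.2 (by simpa using hf.ne_zero)
  have hbp : (⊥ : Ideal (MvPolynomial (Fin 2) K)).IsPrime := Ideal.isPrime_bot
  have h1 := Ideal.height_strict_mono_of_isPrime hb
  have h2 := Ideal.height_strict_mono_of_isPrime hlt
  have h3 := Ideal.height_strict_mono_of_isPrime hIJ'
  have h4 : (J.height : WithBot ℕ∞) ≤ 2 := by
    refine (Ideal.height_le_ringKrullDim_of_isPrime (I := J)).trans ?_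
    rw [MvPolynomial.ringKrullDim_of_isNoetherianRing]
    simp
  have h4' : J.height ≤ 2 := WithBot.coe_le_coe.1 h4
  have h1' := Order.add_one_le_of_lt h1
  have h2' := Order.add_one_le_of_lt h2
  have h3' := Order.add_one_le_of_lt h3
  have h5 : (3 : ℕ∞) ≤ J.height := by
    calc (3 : ℕ∞) = 0 + 1 + 1 + 1 := by norm_num
      _ ≤ (⊥ : Ideal (MvPolynomial (Fin 2) K)).height + 1 + 1 + 1 := by gcongr; exact zero_le
      _ ≤ (Ideal.span {f}).height + 1 + 1 := by gcongr
      _ ≤ I.height + 1 := by gcongr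
      _ ≤ J.height := h3'
  exact absurd (h5.trans h4') (by decide)

theorem finrank_restrictTotalDegree_fin_two (K : Type*) [Field K] (D : ℕ) :
    2 * Module.finrank K (MvPolynomial.restrictTotalDegree (Fin 2) K D) = (D + 1) * (D + 2) := by
  have hb := Module.finrank_eq_nat_card_basis
    (MvPolynomial.basisRestrictSupport K {n : Fin 2 →₀ ℕ | (n.sum fun _ e => e) ≤ D})
  have hsum : ∀ n : Fin 2 →₀ ℕ, (n.sum fun _ e => e) = n 0 + n 1 := fun n => by
    rw [Finsupp.sum_fintype _ _ (fun _ => rfl), Fin.sum_univ_two]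
  let e : {n : Fin 2 →₀ ℕ | (n.sum fun _ e => e) ≤ D} ≃
      (i : Fin (D + 1)) × Fin (D + 1 - i) :=
    { toFun := fun n => ⟨⟨n.1 0, by have := n.2; rw [Set.mem_ofPred_eq, hsum] at this; omega⟩,
        ⟨n.1 1, by have := n.2; rw [Set.mem_ofPred_eq, hsum] at this; dsimp only; omega⟩⟩
      invFun := fun p => ⟨Finsupp.equivFunOnFinite.symm ![p.1, p.2], by
        rw [Set.mem_ofPred_eq, hsum]
        have := p.2.2
        simp
        omega⟩
      left_inv := fun n => by
        ext i
        fin_cases i <;> simp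
      right_inv := fun p => by
        obtain ⟨⟨i, hi⟩, ⟨j, hj⟩⟩ := p
        simp }
  have hc : Nat.card {n : Fin 2 →₀ ℕ | (n.sum fun _ e => e) ≤ D} =
      ∑ i ∈ Finset.range (D + 1), (D + 1 - i) := by
    rw [Nat.card_congr e, Nat.card_sigma, Finset.sum_range]
    simp
  have hg : ∑ i ∈ Finset.range (D + 1), (D + 1 - i) = ∑ i ∈ Finset.range (D + 1), (i + 1) := by
    rw [← Finset.sum_range_reflect]
    refine Finset.sum_congr rfl fun i hi => ?_
    have := Finset.mem_range.1 hi
    omega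
  rw [MvPolynomial.restrictTotalDegree, hb, hc, hg]
  clear hb hc hg e hsum
  induction D with
  | zero => simp
  | succ n ih => rw [Finset.sum_range_succ, mul_add, ih]; ring

/-! ### Vanishing ideal and degree of a Laurent-parametrized curve -/

/-- The plane curve `γ` is parametrized by the Laurent polynomials `P 0 / X ^ M` and `P 1 / X ^ M`
at the points of the unit circle. -/
structure IsLaurentParam (γ : ℝ → Fin 2 → ℝ) (P : Fin 2 → ℂ[X]) (M : ℕ) : Prop where
  natDegree_le : ∀ i, (P i).natDegree ≤ 2 * M
  eval_eq : ∀ i (θ : ℝ), (P i).eval (Complex.exp (θ * Complex.I)) =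
    γ θ i * Complex.exp (θ * Complex.I) ^ M

/-- Substitution of the Laurent polynomials `P i / X ^ M` for the variables. -/
noncomputable def laurentSubst (P : Fin 2 → ℂ[X]) (M : ℕ) :
    MvPolynomial (Fin 2) ℝ →ₐ[ℝ] RatFunc ℂ :=
  MvPolynomial.aeval fun i => algebraMap ℂ[X] (RatFunc ℂ) (P i) / RatFunc.X ^ M

namespace IsLaurentParam

variable {γ : ℝ → Fin 2 → ℝ} {P : Fin 2 → ℂ[X]} {M : ℕ}

/-- X^(MD) is a common denominator: a monomial of degree e ≤ D becomes a product of e numerators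
times X^(M(D-e)) over it. -/
theorem exists_polynomial (h : IsLaurentParam γ P M) {D : ℕ} {g : MvPolynomial (Fin 2) ℝ}
    (hg : g.totalDegree ≤ D) : ∃ p : ℂ[X], p.natDegree ≤ 2 * M * D ∧
      algebraMap ℂ[X] (RatFunc ℂ) p = laurentSubst P M g * RatFunc.X ^ (M * D) ∧
      ∀ θ : ℝ, p.eval (Complex.exp (θ * Complex.I)) =
        (MvPolynomial.aeval (γ θ) g : ℝ) * Complex.exp (θ * Complex.I) ^ (M * D) := by
  have hle : ∀ d ∈ g.support, d 0 + d 1 ≤ D := fun d hd => by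
    have := (MvPolynomial.le_totalDegree hd).trans hg
    rwa [Finsupp.sum_fintype _ _ (fun _ => rfl), Fin.sum_univ_two] at this
  refine ⟨∑ d ∈ g.support, C ((g.coeff d : ℝ) : ℂ) * (P 0 ^ d 0 * P 1 ^ d 1) *
    X ^ (M * (D - (d 0 + d 1))), ?_, ?_, ?_⟩
  · refine natDegree_sum_le_of_forall_le _ _ fun d hd => ?_
    have hd' := hle d hd
    calc _ ≤ 0 + (d 0 * (2 * M) + d 1 * (2 * M)) + M * (D - (d 0 + d 1)) := by
          refine natDegree_mul_le_of_le (natDegree_mul_le_of_le (natDegree_C _).le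
            (natDegree_mul_le_of_le (natDegree_pow_le_of_le _ (h.natDegree_le 0))
              (natDegree_pow_le_of_le _ (h.natDegree_le 1)))) (natDegree_X_pow_le _)
      _ ≤ 2 * M * D := by
          obtain ⟨k, rfl⟩ := Nat.exists_eq_add_of_le hd'
          rw [Nat.add_sub_cancel_left]
          nlinarith [Nat.zero_le (M * k)]
  · rw [laurentSubst, MvPolynomial.aeval_def, MvPolynomial.eval₂_eq', map_sum, Finset.sum_mul]
    refine Finset.sum_congr rfl fun d hd => ?_
    obtain ⟨k, hk⟩ := Nat.exists_eq_add_of_le (hle d hd)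
    have hX := RatFunc.X_ne_zero (K := ℂ)
    have hc : algebraMap ℝ (RatFunc ℂ) (g.coeff d) = RatFunc.C ((g.coeff d : ℝ) : ℂ) := by
      rw [IsScalarTower.algebraMap_apply ℝ ℂ (RatFunc ℂ), RatFunc.algebraMap_eq_C]
      rfl
    rw [Fin.prod_univ_two, hc, hk, Nat.add_sub_cancel_left]
    simp only [map_mul, map_pow, RatFunc.algebraMap_X, RatFunc.algebraMap_C]
    simp only [div_pow, ← pow_mul, mul_add, pow_add]
    field_simp
  · intro θ
    rw [MvPolynomial.aeval_def, MvPolynomial.eval₂_eq', eval_finsetSum, Complex.ofReal_sum,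
      Finset.sum_mul]
    refine Finset.sum_congr rfl fun d hd => ?_
    obtain ⟨k, hk⟩ := Nat.exists_eq_add_of_le (hle d hd)
    rw [Fin.prod_univ_two, hk, Nat.add_sub_cancel_left]
    simp only [eval_mul, eval_pow, eval_C, eval_X, h.eval_eq, Algebra.algebraMap_self,
      RingHom.id_apply, Complex.ofReal_mul, Complex.ofReal_pow]
    ring

theorem aeval_eq_zero (h : IsLaurentParam γ P M) {g : MvPolynomial (Fin 2) ℝ}
    (hg : laurentSubst P M g = 0) (θ : ℝ) : MvPolynomial.aeval (γ θ) g = 0 := by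
  obtain ⟨p, -, h1, h2⟩ := h.exists_polynomial (le_refl g.totalDegree)
  rw [hg, zero_mul, map_eq_zero_iff _ (RatFunc.algebraMap_injective ℂ)] at h1
  have := h2 θ
  rw [h1, eval_zero, eq_comm, mul_eq_zero, or_iff_left (pow_ne_zero _ (Complex.exp_ne_zero _))]
    at this
  exact_mod_cast this

/-- A polynomial of degree at most `D` that vanishes at more than `2 * M * D` points of the curve
vanishes on the curve. -/
theorem laurentSubst_eq_zero (h : IsLaurentParam γ P M) {D : ℕ} {g : MvPolynomial (Fin 2) ℝ}
    (hg : g.totalDegree ≤ D)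
    (hz : ∀ j : Fin (2 * M * D + 1), MvPolynomial.aeval (γ ((j : ℝ) / (2 * M * D + 1 : ℕ))) g = 0) :
    laurentSubst P M g = 0 := by
  obtain ⟨p, h0, h1, h2⟩ := h.exists_polynomial hg
  have hp : p = 0 := by
    refine eq_zero_of_natDegree_lt_card_of_eval_eq_zero p
      (f := fun j : Fin (2 * M * D + 1) =>
        Complex.exp (((j : ℝ) / (2 * M * D + 1 : ℕ) : ℝ) * Complex.I)) ?_ ?_ ?_
    · intro j k hjk
      -- The parameters lie in [0, 1], inside (-π, π], where θ ↦ exp(iθ) is injective.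
      have hmem : ∀ j : Fin (2 * M * D + 1), 0 ≤ (j : ℝ) / (2 * M * D + 1 : ℕ) ∧
          (j : ℝ) / (2 * M * D + 1 : ℕ) ≤ 1 := fun j => by
        refine ⟨by positivity, div_le_one_of_le₀ ?_ (by positivity)⟩
        exact_mod_cast j.2.le
      have hpi := Real.pi_gt_three
      have him : ∀ j : Fin (2 * M * D + 1), (((j : ℝ) / (2 * M * D + 1 : ℕ) : ℝ) *
          Complex.I).im = (j : ℝ) / (2 * M * D + 1 : ℕ) := fun j => by
        rw [Complex.im_ofReal_mul, Complex.I_im, mul_one]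
      have := Complex.exp_inj_of_neg_pi_lt_of_le_pi (by rw [him]; linarith [hmem j])
        (by rw [him]; linarith [hmem j]) (by rw [him]; linarith [hmem k])
        (by rw [him]; linarith [hmem k]) hjk
      have h3 : (j : ℝ) / (2 * M * D + 1 : ℕ) = (k : ℝ) / (2 * M * D + 1 : ℕ) :=
        Complex.ofReal_injective (mul_right_cancel₀ Complex.I_ne_zero this)
      rw [div_left_inj' (by positivity)] at h3
      exact Fin.ext (by exact_mod_cast h3)
    · intro j
      rw [h2, hz j]
      simp
    · simpa using Nat.lt_succ_of_le h0
  rw [hp, map_zero, eq_comm, mul_eq_zero, or_iff_left (pow_ne_zero _ RatFunc.X_ne_zero)] at h1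
  exact h1

theorem vanishingIdeal_eq_ker (h : IsLaurentParam γ P M) :
    MvPolynomial.vanishingIdeal ℝ (γ '' Set.Icc (-Real.pi) Real.pi) =
      RingHom.ker (laurentSubst P M) := by
  ext g
  rw [MvPolynomial.mem_vanishingIdeal_iff, RingHom.mem_ker]
  refine ⟨fun hg => h.laurentSubst_eq_zero le_rfl fun j => hg _ ⟨_, ⟨?_, ?_⟩, rfl⟩, ?_⟩
  · exact le_trans (by linarith [Real.pi_pos]) (by positivity : (0 : ℝ) ≤ _)
  · refine le_trans (div_le_one_of_le₀ ?_ (by positivity)) (by linarith [Real.pi_gt_three])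
    exact_mod_cast j.2.le
  · rintro hg _ ⟨θ, -, rfl⟩
    exact h.aeval_eq_zero hg θ

/-- Evaluation of polynomials of degree at most `D` at sample points of the curve `γ`. -/
noncomputable def sample (γ : ℝ → Fin 2 → ℝ) (M D : ℕ) :
    MvPolynomial.restrictTotalDegree (Fin 2) ℝ D →ₗ[ℝ] Fin (2 * M * D + 1) → ℝ :=
  LinearMap.pi fun j => (MvPolynomial.aeval (γ ((j : ℝ) / (2 * M * D + 1 : ℕ)))).toLinearMap ∘ₗ
    Submodule.subtype _

theorem laurentSubst_eq_zero_of_mem_ker (h : IsLaurentParam γ P M) {D : ℕ}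
    {g : MvPolynomial.restrictTotalDegree (Fin 2) ℝ D} (hg : g ∈ LinearMap.ker (sample γ M D)) :
    laurentSubst P M g = 0 :=
  h.laurentSubst_eq_zero ((MvPolynomial.mem_restrictTotalDegree _ _ _).1 g.2)
    fun j => congrFun (LinearMap.mem_ker.1 hg) j

theorem finrank_le_finrank_ker_sample (γ : ℝ → Fin 2 → ℝ) (M D : ℕ) :
    (D + 1) * (D + 2) ≤ 2 * (2 * M * D + 1 + Module.finrank ℝ (LinearMap.ker (sample γ M D))) := by
  have h1 := LinearMap.finrank_range_add_finrank_ker (sample γ M D)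
  have h2 := Submodule.finrank_le (LinearMap.range (sample γ M D))
  rw [Module.finrank_fin_fun] at h2
  rw [← finrank_restrictTotalDegree_fin_two ℝ D, ← h1]
  omega

theorem ker_laurentSubst_ne_bot (h : IsLaurentParam γ P M) :
    RingHom.ker (laurentSubst P M) ≠ ⊥ := by
  -- In degree 4M+1 the polynomials already outnumber the sampling conditions: (4M+2)(4M+3) >
  -- 2(2M(4M+1)+1).
  have h1 := finrank_le_finrank_ker_sample γ M (4 * M + 1)
  have h2 : Module.finrank ℝ (LinearMap.ker (sample γ M (4 * M + 1))) ≠ 0 := by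
    intro h0
    rw [h0] at h1
    nlinarith
  have : Nontrivial (LinearMap.ker (sample γ M (4 * M + 1))) :=
    Module.nontrivial_of_finrank_pos (Nat.pos_of_ne_zero h2)
  obtain ⟨⟨g, hg⟩, hg0⟩ := exists_ne (0 : LinearMap.ker (sample γ M (4 * M + 1)))
  refine (Submodule.ne_bot_iff _).2 ⟨g, h.laurentSubst_eq_zero_of_mem_ker hg, ?_⟩
  intro h0
  exact hg0 (by ext1; ext1; exact h0)

theorem totalDegree_le (h : IsLaurentParam γ P M) {f : MvPolynomial (Fin 2) ℝ} (hf : f ≠ 0)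
    (hker : RingHom.ker (laurentSubst P M) = Ideal.span {f}) : f.totalDegree ≤ 2 * M := by
  set d := f.totalDegree with hd
  -- A polynomial of degree at most D+d that vanishes at the sample points is f times one of degree
  -- at most D.
  have key : ∀ D, Module.finrank ℝ (LinearMap.ker (sample γ M (D + d))) ≤
      Module.finrank ℝ (MvPolynomial.restrictTotalDegree (Fin 2) ℝ D) := fun D => by
    rw [← Submodule.finrank_map_subtype_eq]
    refine (Submodule.finrank_mono ?_).trans (Submodule.finrank_map_le
      (LinearMap.mulLeft ℝ f) (MvPolynomial.restrictTotalDegree (Fin 2) ℝ D))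
    rintro _ ⟨g, hg, rfl⟩
    have h0 : (g : MvPolynomial (Fin 2) ℝ) ∈ RingHom.ker (laurentSubst P M) :=
      h.laurentSubst_eq_zero_of_mem_ker hg
    rw [hker, Ideal.mem_span_singleton] at h0
    obtain ⟨q, hq⟩ := h0
    refine ⟨q, ?_, hq.symm⟩
    have hgd := (MvPolynomial.mem_restrictTotalDegree _ _ _).1 g.2
    refine (MvPolynomial.mem_restrictTotalDegree _ _ _).2 ?_
    rcases eq_or_ne q 0 with rfl | hq0
    · simp
    · rw [hq, MvPolynomial.totalDegree_mul_of_isDomain hf hq0] at hgd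
      omega
  by_contra! hlt
  -- If d ≥ 2M+1, the count yields 2D + d² + 3d ≤ 4Md + 2, which fails for this D.
  obtain ⟨D, hD⟩ : ∃ D, D = 2 * M * d + 2 := ⟨_, rfl⟩
  have h1 := finrank_le_finrank_ker_sample γ M (D + d)
  have h2 := key D
  have h3 := finrank_restrictTotalDegree_fin_two ℝ D
  have h4 : (2 * M + 1) * D ≤ d * D := Nat.mul_le_mul_right D hlt
  have h5 : (D + d + 1) * (D + d + 2) ≤ 2 * (2 * M * (D + d) + 1) + (D + 1) * (D + 2) := by omega
  nlinarith

end IsLaurentParam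

/-! ### Fourier form of the constant-width curve -/

/-- The polynomial `X ^ (2N+1) * (α/2 + ∑ (u k X ^ (2k+1) + v k X ^ (-2k-1)))`. -/
noncomputable def oddLaurentNum (α : ℝ) (N : ℕ) (u v : ℕ → ℂ) : ℂ[X] :=
  C ((α / 2 : ℝ) : ℂ) * X ^ (2 * N + 1) + ∑ k ∈ Finset.range (N + 1),
    (C (u k) * X ^ (2 * N + 2 + 2 * k) + C (v k) * X ^ (2 * N - 2 * k))

theorem natDegree_oddLaurentNum_le (α : ℝ) (N : ℕ) (u v : ℕ → ℂ) :
    (oddLaurentNum α N u v).natDegree ≤ 4 * N + 2 := by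
  refine natDegree_add_le_of_degree_le ((natDegree_C_mul_X_pow_le _ _).trans (by omega)) ?_
  refine natDegree_sum_le_of_forall_le _ _ fun k hk => ?_
  have := Finset.mem_range.1 hk
  exact natDegree_add_le_of_degree_le ((natDegree_C_mul_X_pow_le _ _).trans (by omega))
    ((natDegree_C_mul_X_pow_le _ _).trans (by omega))

theorem coeff_oddLaurentNum (α : ℝ) (N n : ℕ) (u v : ℕ → ℂ) :
    (oddLaurentNum α N u v).coeff n = (if n = 2 * N + 1 then ((α / 2 : ℝ) : ℂ) else 0) +
      ∑ k ∈ Finset.range (N + 1), ((if n = 2 * N + 2 + 2 * k then u k else 0) +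
        if n = 2 * N - 2 * k then v k else 0) := by
  simp only [oddLaurentNum, coeff_add, finsetSum_coeff, coeff_C_mul_X_pow]

/-- Every exponent in the sum is even. For `holoNum` this is the coefficient of z in x + iy, the one
that excludes a nontrivial symmetry. -/
theorem coeff_oddLaurentNum_middle (α : ℝ) (N : ℕ) (u v : ℕ → ℂ) :
    (oddLaurentNum α N u v).coeff (2 * N + 1) = ((α / 2 : ℝ) : ℂ) := by
  rw [coeff_oddLaurentNum, if_pos rfl, Finset.sum_eq_zero, add_zero]
  intro k _
  rw [if_neg (by omega), if_neg (by omega), add_zero]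

theorem coeff_oddLaurentNum_top (α : ℝ) (N : ℕ) (u v : ℕ → ℂ) :
    (oddLaurentNum α N u v).coeff (4 * N + 2) = u N := by
  rw [coeff_oddLaurentNum, if_neg (by omega), zero_add, Finset.sum_eq_single N]
  · rw [if_pos (by omega), if_neg (by omega), add_zero]
  · intro k _ hk
    rw [if_neg (by omega), if_neg (by omega), add_zero]
  · simp

theorem coeff_oddLaurentNum_zero (α : ℝ) (N : ℕ) (u v : ℕ → ℂ) :
    (oddLaurentNum α N u v).coeff 0 = v N := by
  rw [coeff_oddLaurentNum, if_neg (by omega), zero_add, Finset.sum_eq_single N]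
  · rw [if_neg (by omega), if_pos (by omega), zero_add]
  · intro k hk hkN
    have := Finset.mem_range.1 hk
    rw [if_neg (by omega), if_neg (by omega), add_zero]
  · simp

theorem exp_mul_I_pow (θ : ℝ) (m : ℕ) : Complex.exp (θ * Complex.I) ^ m =
    (Real.cos (m * θ) : ℂ) + Real.sin (m * θ) * Complex.I := by
  rw [← Complex.exp_nat_mul, ← mul_assoc, Complex.exp_mul_I]
  push_cast
  rfl

theorem eval_oddLaurentNum (α : ℝ) (N : ℕ) (u v : ℕ → ℂ) (θ : ℝ) :
    (oddLaurentNum α N u v).eval (Complex.exp (θ * Complex.I)) =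
      ((α / 2 : ℝ) + ∑ k ∈ Finset.range (N + 1),
        ((u k + v k) * Real.cos ((2 * k + 1 : ℕ) * θ) +
          (u k - v k) * Complex.I * Real.sin ((2 * k + 1 : ℕ) * θ))) *
        Complex.exp (θ * Complex.I) ^ (2 * N + 1) := by
  simp only [oddLaurentNum, eval_add, eval_mul, eval_C, eval_pow, eval_X, eval_finsetSum, add_mul,
    Finset.sum_mul]
  congr 1
  refine Finset.sum_congr rfl fun k hk => ?_
  have hk' := Finset.mem_range.1 hk
  set e := Complex.exp (θ * Complex.I)
  have hm := exp_mul_I_pow θ (2 * k + 1)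
  have hcs : (Real.cos ((2 * k + 1 : ℕ) * θ) : ℂ) ^ 2 + Real.sin ((2 * k + 1 : ℕ) * θ) ^ 2 = 1 := by
    exact_mod_cast Real.cos_sq_add_sin_sq _
  set A := Complex.ofReal (Real.cos ((2 * k + 1 : ℕ) * θ))
  set B := Complex.ofReal (Real.sin ((2 * k + 1 : ℕ) * θ))
  have h1 : e ^ (2 * N + 2 + 2 * k) = e ^ (2 * N + 1) * (A + B * Complex.I) := by
    rw [← hm, ← pow_add]
    congr 1
    omega
  have h2 : e ^ (2 * N - 2 * k) = e ^ (2 * N + 1) * (A - B * Complex.I) := by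
    have h3 : e ^ (2 * N + 1) = e ^ (2 * N - 2 * k) * (A + B * Complex.I) := by
      rw [← hm, ← pow_add]
      congr 1
      omega
    rw [h3]
    linear_combination -(e ^ (2 * N - 2 * k)) * hcs +
      e ^ (2 * N - 2 * k) * B ^ 2 * Complex.I_sq
  rw [h1, h2]
  ring

theorem hasDerivAt_oddSupport (α : ℝ) (N : ℕ) (a b : ℕ → ℝ) (θ : ℝ) :
    HasDerivAt (oddSupport α N a b) (∑ k ∈ Finset.range (N + 1), ((2 * k + 1 : ℕ) : ℝ) *
      (b (2 * k + 1) * Real.cos ((2 * k + 1 : ℕ) * θ) -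
        a (2 * k + 1) * Real.sin ((2 * k + 1 : ℕ) * θ))) θ := by
  unfold oddSupport
  refine HasDerivAt.const_add _ (HasDerivAt.fun_sum fun k _ => ?_)
  have h : HasDerivAt (fun θ : ℝ => ((2 * k + 1 : ℕ) : ℝ) * θ) ((2 * k + 1 : ℕ) : ℝ) θ := by
    simpa using (hasDerivAt_id θ).const_mul ((2 * k + 1 : ℕ) : ℝ)
  convert! (h.cos.const_mul (a (2 * k + 1))).add (h.sin.const_mul (b (2 * k + 1))) using 1
  ring

/-- The complex Fourier coefficient of index `2k+1`. -/
noncomputable def oddCoeff (a b : ℕ → ℝ) (k : ℕ) : ℂ :=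
  (a (2 * k + 1) - b (2 * k + 1) * Complex.I) / 2

/-- The complex Fourier coefficient of index `-(2k+1)`. -/
noncomputable def oddCoeffNeg (a b : ℕ → ℝ) (k : ℕ) : ℂ :=
  (a (2 * k + 1) + b (2 * k + 1) * Complex.I) / 2

theorem oddCoeff_ne_zero {a b : ℕ → ℝ} {k : ℕ} (h : a (2 * k + 1) ≠ 0 ∨ b (2 * k + 1) ≠ 0) :
    oddCoeff a b k ≠ 0 := by
  intro h0
  have hre := congrArg Complex.re h0
  have him := congrArg Complex.im h0
  simp [oddCoeff] at hre him
  tauto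

theorem oddCoeffNeg_ne_zero {a b : ℕ → ℝ} {k : ℕ} (h : a (2 * k + 1) ≠ 0 ∨ b (2 * k + 1) ≠ 0) :
    oddCoeffNeg a b k ≠ 0 := by
  intro h0
  have hre := congrArg Complex.re h0
  have him := congrArg Complex.im h0
  simp [oddCoeffNeg] at hre him
  tauto

/-- The numerator of `x + i y`, whose denominator is `X ^ (2N)`. -/
noncomputable def holoNum (α : ℝ) (N : ℕ) (a b : ℕ → ℝ) : ℂ[X] :=
  oddLaurentNum α N (fun k => -(2 * k) * oddCoeff a b k) fun k => (2 * k + 2) * oddCoeffNeg a b k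

/-- The numerator of `x - i y`, whose denominator is `X ^ (2N+2)`. -/
noncomputable def antiNum (α : ℝ) (N : ℕ) (a b : ℕ → ℝ) : ℂ[X] :=
  oddLaurentNum α N (fun k => (2 * k + 2) * oddCoeff a b k) fun k => -(2 * k) * oddCoeffNeg a b k

/-- The operator p ↦ p + ip' multiplies exp(inθ) by 1 - n: by -2k at n = 2k+1 and by 2k+2 at n =
-(2k+1). For p - ip' the factor is 1 + n. -/
theorem eval_holoNum (α : ℝ) (N : ℕ) (a b : ℕ → ℝ) (θ : ℝ) :
    (holoNum α N a b).eval (Complex.exp (θ * Complex.I)) =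
      (oddSupport α N a b θ + deriv (oddSupport α N a b) θ * Complex.I) *
        Complex.exp (θ * Complex.I) ^ (2 * N + 1) := by
  rw [holoNum, eval_oddLaurentNum, (hasDerivAt_oddSupport α N a b θ).deriv, oddSupport]
  congr 1
  simp only [Complex.ofReal_add, Complex.ofReal_sum, Finset.sum_mul, add_assoc]
  rw [← Finset.sum_add_distrib]
  congr 1
  refine Finset.sum_congr rfl fun k _ => ?_
  simp only [oddCoeff, oddCoeffNeg, Complex.ofReal_sub, Complex.ofReal_mul,
    Complex.ofReal_natCast]
  push_cast
  linear_combination (b (2 * k + 1) * Complex.sin ((2 * k + 1) * θ)) * (-Complex.I_sq)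

theorem eval_antiNum (α : ℝ) (N : ℕ) (a b : ℕ → ℝ) (θ : ℝ) :
    (antiNum α N a b).eval (Complex.exp (θ * Complex.I)) =
      (oddSupport α N a b θ - deriv (oddSupport α N a b) θ * Complex.I) *
        Complex.exp (θ * Complex.I) ^ (2 * N + 1) := by
  rw [antiNum, eval_oddLaurentNum, (hasDerivAt_oddSupport α N a b θ).deriv, oddSupport]
  congr 1
  simp only [Complex.ofReal_add, Complex.ofReal_sum, Finset.sum_mul, add_sub_assoc]
  rw [← Finset.sum_sub_distrib]
  congr 1
  refine Finset.sum_congr rfl fun k _ => ?_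
  simp only [oddCoeff, oddCoeffNeg, Complex.ofReal_sub, Complex.ofReal_mul,
    Complex.ofReal_natCast]
  push_cast
  linear_combination (b (2 * k + 1) * Complex.sin ((2 * k + 1) * θ)) * (-Complex.I_sq)

/-- The numerators of the coordinates, with the common denominator `X ^ (2N+2)`. -/
noncomputable def coordNum (α : ℝ) (N : ℕ) (a b : ℕ → ℝ) : Fin 2 → ℂ[X] :=
  ![C (1 / 2) * (holoNum α N a b * X ^ 2 + C 1 * antiNum α N a b),
    C (-Complex.I / 2) * (holoNum α N a b * X ^ 2 + C (-1) * antiNum α N a b)]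

theorem natDegree_combination_le (α : ℝ) (N : ℕ) (a b : ℕ → ℝ) (s t : ℂ) :
    (C s * (holoNum α N a b * X ^ 2 + C t * antiNum α N a b)).natDegree ≤ 4 * N + 4 := by
  refine (natDegree_C_mul_le _ _).trans (natDegree_add_le_of_degree_le ?_ ?_)
  · have := natDegree_mul_le_of_le
      (natDegree_oddLaurentNum_le α N _ _ : (holoNum α N a b).natDegree ≤ _)
      (natDegree_X_pow_le (R := ℂ) 2)
    exact this
  · exact (natDegree_C_mul_le _ _).trans
      ((natDegree_oddLaurentNum_le α N _ _).trans (by omega))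

/-- The top coefficient comes from `holoNum` alone and carries the factor -2N, hence the need for N
≠ 0. The constant coefficient likewise comes from `antiNum` alone. -/
theorem natDegree_combination {α : ℝ} {N : ℕ} {a b : ℕ → ℝ} (hN : N ≠ 0)
    (h : a (2 * N + 1) ≠ 0 ∨ b (2 * N + 1) ≠ 0) {s : ℂ} (hs : s ≠ 0) (t : ℂ) :
    (C s * (holoNum α N a b * X ^ 2 + C t * antiNum α N a b)).natDegree = 4 * N + 4 := by
  refine le_antisymm (natDegree_combination_le α N a b s t) (le_natDegree_of_ne_zero ?_)
  have h1 : (antiNum α N a b).coeff (4 * N + 2 + 2) = 0 :=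
    coeff_eq_zero_of_natDegree_lt ((natDegree_oddLaurentNum_le α N _ _).trans_lt (by omega))
  rw [coeff_C_mul, show 4 * N + 4 = 4 * N + 2 + 2 from rfl, coeff_add, coeff_C_mul, h1,
    coeff_mul_X_pow, holoNum, coeff_oddLaurentNum_top]
  have := oddCoeff_ne_zero h
  simp [hs, this, hN]

theorem coeff_zero_combination {α : ℝ} {N : ℕ} {a b : ℕ → ℝ} (hN : N ≠ 0)
    (h : a (2 * N + 1) ≠ 0 ∨ b (2 * N + 1) ≠ 0) {s t : ℂ} (hs : s ≠ 0) (ht : t ≠ 0) :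
    (C s * (holoNum α N a b * X ^ 2 + C t * antiNum α N a b)).coeff 0 ≠ 0 := by
  rw [coeff_C_mul, coeff_add, coeff_C_mul, mul_coeff_zero, antiNum, coeff_oddLaurentNum_zero]
  have := oddCoeffNeg_ne_zero h
  simp [hs, ht, this, hN]

theorem natDegree_coordNum {α : ℝ} {N : ℕ} {a b : ℕ → ℝ} (hN : N ≠ 0)
    (h : a (2 * N + 1) ≠ 0 ∨ b (2 * N + 1) ≠ 0) (i : Fin 2) :
    (coordNum α N a b i).natDegree = 4 * N + 4 := by
  fin_cases i
  · exact natDegree_combination hN h (by norm_num) _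
  · exact natDegree_combination hN h (by simp) _

theorem coeff_zero_coordNum {α : ℝ} {N : ℕ} {a b : ℕ → ℝ} (hN : N ≠ 0)
    (h : a (2 * N + 1) ≠ 0 ∨ b (2 * N + 1) ≠ 0) (i : Fin 2) :
    (coordNum α N a b i).coeff 0 ≠ 0 := by
  fin_cases i
  · exact coeff_zero_combination hN h (by norm_num) (by norm_num)
  · exact coeff_zero_combination hN h (by simp) (by norm_num)

theorem isLaurentParam_coordNum (α : ℝ) (N : ℕ) (a b : ℕ → ℝ) :
    IsLaurentParam (param (oddSupport α N a b)) (coordNum α N a b) (2 * N + 2) where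
  natDegree_le i := by
    have : 2 * (2 * N + 2) = 4 * N + 4 := by ring
    rw [this]
    fin_cases i <;> exact natDegree_combination_le α N a b _ _
  eval_eq i θ := by
    have he : Complex.exp (θ * Complex.I) = (Real.cos θ : ℂ) + Real.sin θ * Complex.I := by
      simpa using exp_mul_I_pow θ 1
    have h1 := eval_holoNum α N a b θ
    have h2 := eval_antiNum α N a b θ
    have hcs : (Real.cos θ : ℂ) ^ 2 + (Real.sin θ : ℂ) ^ 2 = 1 := by
      exact_mod_cast Real.cos_sq_add_sin_sq θ
    set p := Complex.ofReal (oddSupport α N a b θ) with hp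
    set p' := Complex.ofReal (deriv (oddSupport α N a b) θ) with hp'
    set c := Complex.ofReal (Real.cos θ)
    set s := Complex.ofReal (Real.sin θ)
    have hinv : Complex.exp (θ * Complex.I) * (c - s * Complex.I) = 1 := by
      rw [he]
      linear_combination hcs - s ^ 2 * Complex.I_sq
    set e := Complex.exp (θ * Complex.I)
    have hpow : e ^ (2 * N + 1) = e ^ (2 * N + 2) * (c - s * Complex.I) := by
      linear_combination -(e ^ (2 * N + 1)) * hinv
    have hpow2 : e ^ (2 * N + 1) * e ^ 2 = e ^ (2 * N + 2) * (c + s * Complex.I) := by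
      rw [← he]
      ring
    have hI := Complex.I_sq
    fin_cases i
    · simp only [coordNum, param, Fin.zero_eta, Matrix.cons_val_zero, eval_mul, eval_add, eval_C,
        eval_pow, eval_X, h1, h2, Complex.ofReal_sub, Complex.ofReal_mul]
      rw [← hp, ← hp']
      linear_combination (1 / 2) * (p + p' * Complex.I) * hpow2 +
        (1 / 2) * (p - p' * Complex.I) * hpow + e ^ (2 * N + 2) * p' * s * hI
    · simp only [coordNum, param, Fin.mk_one, Matrix.cons_val_one, Matrix.cons_val_fin_one,
        eval_mul, eval_add, eval_C,
        eval_pow, eval_X, h1, h2, Complex.ofReal_add, Complex.ofReal_mul]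
      rw [← hp, ← hp']
      linear_combination (-Complex.I / 2) * (p + p' * Complex.I) * hpow2 +
        (Complex.I / 2) * (p - p' * Complex.I) * hpow -
        e ^ (2 * N + 2) * (p * s + p' * c) * hI

/-- For `N = 0` the curve is a circle. -/
theorem isCircle_curve_oddSupport_zero {α : ℝ} (hα : 0 < α) (a b : ℕ → ℝ) :
    IsCircle (curve (oddSupport α 0 a b)) := by
  have hx : ∀ θ, param (oddSupport α 0 a b) θ =
      ![α / 2 * Real.cos θ + a 1, α / 2 * Real.sin θ + b 1] := fun θ => by
    have hcs := Real.cos_sq_add_sin_sq θ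
    rw [param, (hasDerivAt_oddSupport α 0 a b θ).deriv, oddSupport]
    simp only [zero_add, Finset.range_one, Finset.sum_singleton, mul_zero, Nat.cast_one, one_mul]
    congr 1
    · linear_combination a 1 * hcs
    · congr 1
      linear_combination b 1 * hcs
  refine ⟨![a 1, b 1], α / 2, by positivity, ?_⟩
  ext q
  constructor
  · rintro ⟨θ, -, rfl⟩
    rw [hx]
    simp only [Set.mem_ofPred_eq, Matrix.cons_val_zero, Matrix.cons_val_one]
    linear_combination (α / 2) ^ 2 * Real.cos_sq_add_sin_sq θ
  · intro hq
    simp only [Set.mem_ofPred_eq, Matrix.cons_val_zero, Matrix.cons_val_one] at hq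
    let z : ℂ := ⟨q 0 - a 1, q 1 - b 1⟩
    have hz : ‖z‖ = α / 2 := by
      rw [Complex.norm_def, Complex.normSq_apply, ← Real.sqrt_sq (by positivity : 0 ≤ α / 2), ← hq]
      congr 1
      simp only [z]
      ring
    refine ⟨z.arg, ⟨(Complex.neg_pi_lt_arg z).le, Complex.arg_le_pi z⟩, ?_⟩
    rw [hx, ← hz, Complex.norm_mul_cos_arg, Complex.norm_mul_sin_arg]
    funext i
    fin_cases i <;> simp [z]

/-! ### Function field of the curve and birationality -/

/-- The coordinates of the curve as rational functions of `exp (i θ)`. -/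
noncomputable def coord (α : ℝ) (N : ℕ) (a b : ℕ → ℝ) (i : Fin 2) : RatFunc ℂ :=
  algebraMap ℂ[X] (RatFunc ℂ) (coordNum α N a b i) / RatFunc.X ^ (2 * N + 2)

theorem finrank_adjoin_div_X_pow {K : Type*} [Field K] {p : K[X]} (h0 : p.coeff 0 ≠ 0) {m : ℕ}
    (hm : m ≤ p.natDegree) :
    Module.finrank K⟮(algebraMap K[X] (RatFunc K) p / RatFunc.X ^ m)⟯ (RatFunc K) =
      p.natDegree := by
  have hcop : IsCoprime p (X ^ m) := by
    refine IsCoprime.pow_right (IsCoprime.symm ?_)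
    exact (prime_X.irreducible.coprime_iff_not_dvd).2 fun h => h0 (X_dvd_iff.1 h)
  have := finrank_adjoin_div_of_isCoprime (pow_ne_zero m X_ne_zero) hcop
  rwa [map_pow, RatFunc.algebraMap_X, natDegree_X_pow, max_eq_left hm] at this

section

variable {α : ℝ} {N : ℕ} {a b : ℕ → ℝ}

theorem finrank_adjoin_coord (hN : N ≠ 0) (h : a (2 * N + 1) ≠ 0 ∨ b (2 * N + 1) ≠ 0) (i : Fin 2) :
    Module.finrank ℂ⟮coord α N a b i⟯ (RatFunc ℂ) = 4 * N + 4 := by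
  have hd := natDegree_coordNum (α := α) hN h i
  rw [coord, finrank_adjoin_div_X_pow (coeff_zero_coordNum hN h i) (by omega), hd]

theorem coord_ne_C (hN : N ≠ 0) (h : a (2 * N + 1) ≠ 0 ∨ b (2 * N + 1) ≠ 0) (i : Fin 2) :
    ¬ ∃ c, coord α N a b i = RatFunc.C c := by
  rintro ⟨c, hc⟩
  have := finrank_adjoin_coord (α := α) hN h i
  -- For a constant the degree formula gives 0.
  rw [hc, RatFunc.finrank_eq_max_natDegree] at this
  simp at this

theorem transcendental_coord (hN : N ≠ 0) (h : a (2 * N + 1) ≠ 0 ∨ b (2 * N + 1) ≠ 0) (i : Fin 2) :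
    Transcendental ℝ (coord α N a b i) := fun H =>
  RatFunc.transcendental_of_ne_C _ (coord_ne_C hN h i) (H.tower_top ℂ)

theorem coord_add_I_mul_coord :
    coord α N a b 0 + algebraMap ℂ (RatFunc ℂ) Complex.I * coord α N a b 1 =
      algebraMap ℂ[X] (RatFunc ℂ) (holoNum α N a b) / RatFunc.X ^ (2 * N) := by
  have hnum : coordNum α N a b 0 + C Complex.I * coordNum α N a b 1 =
      holoNum α N a b * X ^ 2 := by
    have h1 : (C (1 / 2) : ℂ[X]) + C (1 / 2) = 1 := by rw [← C_add]; norm_num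
    have h2 : (C Complex.I : ℂ[X]) * C (-Complex.I / 2) = C (1 / 2) := by
      rw [← C_mul]
      congr 1
      linear_combination (-1 / 2) * Complex.I_sq
    simp only [coordNum, Matrix.cons_val_zero, Matrix.cons_val_one, Matrix.cons_val_fin_one,
      map_one, map_neg]
    linear_combination holoNum α N a b * X ^ 2 * h1 +
      (holoNum α N a b * X ^ 2 - antiNum α N a b) * h2
  have hX := RatFunc.X_ne_zero (K := ℂ)
  rw [coord, coord, ← mul_div_assoc, ← add_div, RatFunc.algebraMap_eq_C, ← RatFunc.algebraMap_C,
    ← map_mul, ← map_add, hnum, map_mul, map_pow, RatFunc.algebraMap_X, pow_add,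
    mul_div_mul_right _ _ (pow_ne_zero 2 hX)]

/-- The parametrization is birational. -/
theorem adjoin_coord_eq_top (hα : α ≠ 0) (hN : N ≠ 0)
    (h : a (2 * N + 1) ≠ 0 ∨ b (2 * N + 1) ≠ 0) :
    ℂ⟮coord α N a b 0, coord α N a b 1⟯ = ⊤ := by
  set E := ℂ⟮coord α N a b 0, coord α N a b 1⟯ with hE
  have h0 : coord α N a b 0 ∈ E := subset_adjoin _ _ (by simp)
  have h1 : coord α N a b 1 ∈ E := subset_adjoin _ _ (by simp)
  have hc0 : (holoNum α N a b).coeff 0 ≠ 0 := by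
    rw [holoNum, coeff_oddLaurentNum_zero]
    refine mul_ne_zero ?_ (oddCoeffNeg_ne_zero h)
    exact_mod_cast (by omega : 2 * N + 2 ≠ 0)
  have hdeg : (holoNum α N a b).natDegree = 2 * N + (2 * N + 2) := by
    rw [← add_assoc, ← two_mul, ← mul_assoc]
    refine le_antisymm (natDegree_oddLaurentNum_le α N _ _) (le_natDegree_of_ne_zero ?_)
    change (holoNum α N a b).coeff (4 * N + 2) ≠ 0
    rw [holoNum, coeff_oddLaurentNum_top]
    simpa [hN] using oddCoeff_ne_zero h
  have hz : algebraMap ℂ[X] (RatFunc ℂ) (holoNum α N a b) / RatFunc.X ^ (2 * N) ∈ E := by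
    rw [← coord_add_I_mul_coord]
    exact E.add_mem h0 (E.mul_mem (E.algebraMap_mem _) h1)
  refine eq_top_of_finrank_dvd_two (by omega) hdeg hc0 ?_ E hz ?_
  · rw [holoNum, coeff_oddLaurentNum_middle]
    exact_mod_cast div_ne_zero hα two_ne_zero
  · have d1 := finrank_dvd_of_le_left (adjoin_simple_le_iff.2 h0)
    have d2 := finrank_dvd_of_le_left (adjoin_simple_le_iff.2 hz)
    rw [finrank_adjoin_coord hN h] at d1
    rw [finrank_adjoin_div_X_pow hc0 (by omega), hdeg] at d2
    -- The index of E divides the degrees 4N+4 of x and 4N+2 of x + iy, hence their difference.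
    have : 2 = 4 * N + 4 - (2 * N + (2 * N + 2)) := by omega
    rw [this]
    exact Nat.dvd_sub d1 d2

/-! ### Existence and degrees of the defining polynomial -/

theorem exists_isDefiningPolynomial (hN : N ≠ 0) (h : a (2 * N + 1) ≠ 0 ∨ b (2 * N + 1) ≠ 0) :
    ∃ f, IsDefiningPolynomial f (curve (oddSupport α N a b)) := by
  have hpar := isLaurentParam_coordNum α N a b
  have hker : MvPolynomial.vanishingIdeal ℝ (curve (oddSupport α N a b)) = _ :=
    hpar.vanishingIdeal_eq_ker
  have hprime : (RingHom.ker (laurentSubst (coordNum α N a b) (2 * N + 2))).IsPrime :=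
    RingHom.ker_isPrime _
  obtain ⟨f, hf, hI⟩ := exists_irreducible_span_eq _ hpar.ker_laurentSubst_ne_bot fun hmax => by
    -- A maximal kernel would be the ideal of the single point q of the curve, making x constant.
    let q := param (oddSupport α N a b) 0
    have hle : RingHom.ker (laurentSubst (coordNum α N a b) (2 * N + 2)) ≤
        MvPolynomial.vanishingIdeal ℝ {q} := fun g hg =>
      (MvPolynomial.mem_vanishingIdeal_singleton_iff _ _).2 (hpar.aeval_eq_zero hg 0)
    have hne : MvPolynomial.vanishingIdeal ℝ {q} ≠ ⊤ := fun ht => by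
      have h1 := (Ideal.eq_top_iff_one _).1 ht
      rw [MvPolynomial.mem_vanishingIdeal_singleton_iff] at h1
      simp at h1
    have hmem : MvPolynomial.X 0 - MvPolynomial.C (q 0) ∈
        RingHom.ker (laurentSubst (coordNum α N a b) (2 * N + 2)) := by
      rw [hmax.eq_of_le hne hle, MvPolynomial.mem_vanishingIdeal_singleton_iff]
      simp
    rw [RingHom.mem_ker, map_sub, sub_eq_zero, laurentSubst, MvPolynomial.aeval_X,
      MvPolynomial.aeval_C] at hmem
    refine coord_ne_C (α := α) hN h 0 ⟨(q 0 : ℂ), hmem.trans ?_⟩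
    rw [IsScalarTower.algebraMap_apply ℝ ℂ (RatFunc ℂ), RatFunc.algebraMap_eq_C]
    rfl
  exact ⟨f, hf, hker.trans hI⟩

theorem degrees_of_isDefiningPolynomial (hα : α ≠ 0) (hN : N ≠ 0)
    (h : a (2 * N + 1) ≠ 0 ∨ b (2 * N + 1) ≠ 0) {f : MvPolynomial (Fin 2) ℝ}
    (hf : IsDefiningPolynomial f (curve (oddSupport α N a b))) :
    f.totalDegree = 4 * N + 4 ∧ MvPolynomial.degreeOf 0 f = 4 * N + 4 ∧
      MvPolynomial.degreeOf 1 f = 4 * N + 4 := by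
  have hpar := isLaurentParam_coordNum α N a b
  have hker : RingHom.ker (laurentSubst (coordNum α N a b) (2 * N + 2)) = Ideal.span {f} :=
    hpar.vanishingIdeal_eq_ker.symm.trans hf.2
  have hf0 := hf.1.ne_zero
  have hupper : f.totalDegree ≤ 4 * N + 4 :=
    (hpar.totalDegree_le hf0 hker).trans (by omega)
  have hzero : laurentSubst (coordNum α N a b) (2 * N + 2) f = 0 := by
    rw [← RingHom.mem_ker, hker]
    exact Ideal.mem_span_singleton_self f
  have hzero' : MvPolynomial.aeval ![coord α N a b 0, coord α N a b 1] f = 0 := by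
    rw [← hzero, laurentSubst]
    congr 2
    funext i
    fin_cases i <;> rfl
  have htop := adjoin_coord_eq_top hα hN h
  have hr := fun i => finrank_adjoin_coord (α := α) hN h i
  have h0 := finrank_le_degreeOf_zero (k := ℂ) _ _ (transcendental_coord hN h 1)
    (by rw [hr]; omega) (by rw [Set.pair_comm]; exact htop) hf0 hzero'
  have h1 := finrank_le_degreeOf_one (k := ℂ) _ _ (transcendental_coord hN h 0)
    (by rw [hr]; omega) htop hf0 hzero'
  rw [hr] at h0 h1
  have h2 := MvPolynomial.degreeOf_le_totalDegree f 0
  have h3 := MvPolynomial.degreeOf_le_totalDegree f 1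
  omega

end

end ConstantWidth

theorem theorem2p2 (C : Set (Fin 2 → ℝ)) (α : ℝ) (N : ℕ) (a b : ℕ → ℝ)
    (hC : ConstantWidth.IsConstantWidthCurve C α N a b)
    (hcirc : ¬ ConstantWidth.IsCircle C)
    (htop : a (2 * N + 1) ≠ 0 ∨ b (2 * N + 1) ≠ 0) :
    (∃ f : MvPolynomial (Fin 2) ℝ, ConstantWidth.IsDefiningPolynomial f C) ∧
    ∀ f : MvPolynomial (Fin 2) ℝ, ConstantWidth.IsDefiningPolynomial f C →
      f.totalDegree = 4 * N + 4 ∧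
      MvPolynomial.degreeOf 0 f = 4 * N + 4 ∧
      MvPolynomial.degreeOf 1 f = 4 * N + 4 := by
  obtain ⟨hα, rfl, -⟩ := hC
  have hN : N ≠ 0 := by
    rintro rfl
    exact hcirc (ConstantWidth.isCircle_curve_oddSupport_zero hα a b)
  exact ⟨ConstantWidth.exists_isDefiningPolynomial hN htop, fun f hf =>
    ConstantWidth.degrees_of_isDefiningPolynomial hα.ne' hN htop hf⟩
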